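/- Let $n\ge 2$ and let $C=[-\tfrac12,\tfrac12]^n\subset\mathbb{R}^n$ be the unit $n$-cube centred at the origin. For a unit vector $u=(x_1,\dots,x_n)$ let $P_u$ be the orthogonal projection of $C$ onto the hyperplane $u^{\perp}$, a convex polytope in the $(n-1)$-dimensional Euclidean space $u^\perp$. Let $vl(u)$ be the $(n-1)$-dimensional volume of $P_u$, and let $mw(u)$ be the mean width of $P_u$ within $u^{\perp}$, that is, the average over uniformly distributed unit vectors $v\in u^\perp$ of the width $\max_{p\in P_u}\langle v,p\rangle-\min_{p\in P_u}\langle v,p\rangle$. Let $\mathbb{E}$ denote expectation when $u$ is uniformly distributed on the unit sphere of $\mathbb{R}^n$. (a) For $n=4$ and every unit vector $u$, $$mw(u)=\frac12\sum_{i=1}^4\sqrt{1-x_i^2}.$$ (b) For $n=4$, $$\mathbb{E}(mw)=\frac{16}{3\pi}=\mathbb{E}(vl).$$ (c) For $n=4$, $$\mathbb{E}(mw^2)=3\left(\frac14+\frac{\pi}{8}+\frac1\pi\right)<1+\frac6\pi=\mathbb{E}(vl^2).$$ (d) For $n=4$, as $u$ ranges over all unit vectors, the maximum of $mw(u)$ is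 $\sqrt3$ and the minimum is $3/2$; both are attained. (e) For every $n\ge2$, $$\mathbb{E}(mw)=\frac{n}{\sqrt\pi}\,\frac{\Gamma\left(\frac n2\right)}{\Gamma\left(\frac{n+1}2\right)}=\mathbb{E}(vl).$$ -/

import Mathlib

open MeasureTheory
open scoped RealInnerProductSpace

noncomputable section

namespace CubeProjection

section General

variable (E : Type*) [NormedAddCommGroup E] [InnerProductSpace ℝ E] [FiniteDimensional ℝ E]
  [MeasurableSpace E] [BorelSpace E]

/-- Lebesgue measure of a finite-dimensional Euclidean space `E`, normalised so that the unit
cube spanned by an orthonormal basis has measure `1`. It is written out explicitly because, for a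
subspace, the notation `volume` could also mean the restriction of the ambient measure. -/
def lebesgue : Measure E := (stdOrthonormalBasis ℝ E).toBasis.addHaar

/-- The uniform distribution on the unit sphere of `E`: normalised surface measure. -/
def uniformSphere : Measure (Metric.sphere (0 : E) 1) :=
  ((lebesgue E).toSphere Set.univ)⁻¹ • (lebesgue E).toSphere

variable {E}

/-- Width of `K` in direction `v` (for a unit vector `v`): the distance between the two supporting
hyperplanes of `K` orthogonal to `v`. -/
def width (K : Set E) (v : E) : ℝ :=
  sSup ((fun x : E => ⟪v, x⟫) '' K) - sInf ((fun x : E => ⟪v, x⟫) '' K)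

/-- Mean width of `K`, as a subset of the Euclidean space `E`: the average of the width over all
directions in the unit sphere of `E`. -/
def meanWidth (K : Set E) : ℝ :=
  ∫ v : Metric.sphere (0 : E) 1, width K (v : E) ∂(uniformSphere E)

end General

/-- The unit `n`-cube centred at the origin. -/
def cube (n : ℕ) : Set (EuclideanSpace ℝ (Fin n)) := {x | ∀ i, |x i| ≤ 1 / 2}

/-- The unit sphere of `ℝⁿ`. -/
abbrev Sph (n : ℕ) : Type := Metric.sphere (0 : EuclideanSpace ℝ (Fin n)) 1

/-- The hyperplane of all vectors orthogonal to `u`. -/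
abbrev hyperplane {n : ℕ} (u : Sph n) : Submodule ℝ (EuclideanSpace ℝ (Fin n)) :=
  (Submodule.span ℝ {(u : EuclideanSpace ℝ (Fin n))})ᗮ

/-- The orthogonal projection of the cube onto the hyperplane orthogonal to `u`, as a subset of
that hyperplane. -/
def projectedCube {n : ℕ} (u : Sph n) : Set (hyperplane u) :=
  (fun x : EuclideanSpace ℝ (Fin n) => (hyperplane u).orthogonalProjectionOnto x) '' cube n

/-- The `(n-1)`-dimensional volume of the projected cube. -/
def vl {n : ℕ} (u : Sph n) : ℝ := (lebesgue (hyperplane u) (projectedCube u)).toReal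

/-- The mean width of the projected cube, within the `(n-1)`-dimensional hyperplane. -/
def mw {n : ℕ} (u : Sph n) : ℝ := meanWidth (projectedCube u)

/-- Expectation of `f U`, where `U` is uniformly distributed on the unit sphere of `ℝⁿ`. -/
def expect {n : ℕ} (f : Sph n → ℝ) : ℝ :=
  ∫ u, f u ∂(uniformSphere (EuclideanSpace ℝ (Fin n)))

end CubeProjection

end

/-! The support function of the centred cube is half the `ℓ¹`-norm, so `P_u` has width `∑ |v i|` in
a direction `v ⊥ u`. Since `|v i| = |⟪q, v⟫|`, where `q` is the projection of the `i`-th basis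
vector to `u^⊥` and `‖q‖ = √(1 - u i ^ 2)`, averaging over `v` gives `mw u = c (n-1) * ∑ √(1 - u i ^
2)` (`mw_eq`), with `c = meanAbsCoord` the mean absolute coordinate on a sphere. Part (a) is `c 3 =
1/2`. The extrema in (d) follow from `∑ (1 - u i ^ 2) = 3`, by Cauchy–Schwarz above and `t ≤ √t` on
`[0, 1]` below.

On the other side, `vl u = ∑ |u i|` (`vl_eq`). The part of the cube that leaves it under translation
by `t u` has volume `1 - ∏ (1 - t |u i|)`. By Fubini along `u`, it is also the integral over `P_u`
of the length each fibre loses; that length divided by `t` is at most `1` and tends to `1` on the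
interior. As `t → 0` both sides converge, to `∑ |u i|` and to the volume of `P_u`.

Spherical means of homogeneous functions are read off from Gaussian integrals, which factor over
orthogonal splittings. This gives `c` and the identity `c (n-1) * E √(1 - u i ^ 2) = c n`
(`integral_uniformSphere_sqrt`), so both expectations equal `n * c n`.

For the second moments when `n = 4`, two coordinates of a uniform point of the 3-sphere are uniform
on the unit disk (`map_uniformSphere_four`). The cross terms thereby become elementary double
integrals, while the diagonal terms have constant sum. -/

noncomputable section

namespace CubeProjection

open Set Metric Module

/-! ### Orthogonal splitting along a unit vector -/

section OrthogonalSplitting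

variable {E : Type*} [NormedAddCommGroup E] [InnerProductSpace ℝ E]

theorem finrank_orthogonal_span [FiniteDimensional ℝ E] {e : E} (he : ‖e‖ = 1) :
    finrank ℝ (Submodule.span ℝ {e})ᗮ + 1 = finrank ℝ E := by
  have h := (Submodule.span ℝ {e}).finrank_add_finrank_orthogonal
  rw [finrank_span_singleton (by rintro rfl; simp at he)] at h
  omega

theorem norm_smul_add_orthogonal_sq {e : E} (he : ‖e‖ = 1) (t : ℝ)
    (y : (Submodule.span ℝ {e})ᗮ) : ‖t • e + (y : E)‖ ^ 2 = t ^ 2 + ‖y‖ ^ 2 := by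
  have h : ⟪t • e, (y : E)⟫ = 0 :=
    y.2 _ (Submodule.smul_mem _ _ (Submodule.mem_span_singleton_self e))
  have := norm_add_sq_eq_norm_sq_add_norm_sq_of_inner_eq_zero _ _ h
  simp only [← pow_two, norm_smul, he, mul_one, Real.norm_eq_abs, sq_abs] at this
  exact this

theorem inner_smul_add_orthogonal {e : E} (he : ‖e‖ = 1) (t : ℝ)
    (y : (Submodule.span ℝ {e})ᗮ) : ⟪e, t • e + (y : E)⟫ = t := by
  have h : ⟪e, (y : E)⟫ = 0 := y.2 _ (Submodule.mem_span_singleton_self e)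
  simp [inner_add_right, inner_smul_right, h, he]

end OrthogonalSplitting

/-! ### Spherical averages through Gaussian integrals -/

section SphereAverages

variable {E : Type*} [NormedAddCommGroup E] [InnerProductSpace ℝ E] [FiniteDimensional ℝ E]
  [MeasurableSpace E] [BorelSpace E]

instance : (lebesgue E).IsAddHaarMeasure := by unfold lebesgue; infer_instance

instance [Nontrivial E] : IsProbabilityMeasure (uniformSphere E) := by
  constructor
  rw [uniformSphere, Measure.smul_apply, smul_eq_mul]
  refine ENNReal.inv_mul_cancel ?_ (measure_ne_top _ _)
  exact Measure.measure_univ_ne_zero.2 (Measure.toSphere_ne_zero _)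

theorem integral_uniformSphere (f : sphere (0 : E) 1 → ℝ) :
    ∫ v, f v ∂uniformSphere E
      = ((lebesgue E).toSphere.real univ)⁻¹ * ∫ v, f v ∂(lebesgue E).toSphere := by
  rw [uniformSphere, integral_smul_measure, smul_eq_mul, ENNReal.toReal_inv]
  rfl

/-- Integration in polar coordinates of a positively homogeneous function against a Gaussian. -/
theorem integral_mul_gaussian_eq_toSphere [Nontrivial E] (k : ℕ) {f : E → ℝ}
    (hf : ∀ r : ℝ, 0 < r → ∀ x, f (r • x) = r ^ k * f x) :
    ∫ x, f x * Real.exp (-‖x‖ ^ 2) ∂lebesgue E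
      = (∫ v : sphere (0 : E) 1, f v ∂(lebesgue E).toSphere)
        * (1 / 2 * Real.Gamma (((finrank ℝ E + k : ℕ) : ℝ) / 2)) := by
  set μ := lebesgue E
  have hd : 0 < finrank ℝ E := finrank_pos
  have hrad : ∫ r in Ioi (0 : ℝ), r ^ (finrank ℝ E - 1) * (r ^ k * Real.exp (-r ^ 2))
      = 1 / 2 * Real.Gamma (((finrank ℝ E + k : ℕ) : ℝ) / 2) := by
    -- The exponent collects `r ^ (d - 1)` from the polar volume element and `r ^ k` from
    -- homogeneity.
    have h := integral_rpow_mul_exp_neg_rpow (p := 2) (q := ((finrank ℝ E - 1 + k : ℕ) : ℝ))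
      two_pos (lt_of_lt_of_le (by norm_num) (Nat.cast_nonneg _))
    rw [show ((finrank ℝ E - 1 + k : ℕ) : ℝ) + 1 = ((finrank ℝ E + k : ℕ) : ℝ) by
      norm_cast; omega] at h
    rw [← h]
    refine setIntegral_congr_fun measurableSet_Ioi fun r hr => ?_
    simp only [Real.rpow_natCast, Real.rpow_two]
    rw [pow_add, mul_assoc]
  calc
    _ = ∫ x : ({(0)}ᶜ : Set E), f x * Real.exp (-‖x.1‖ ^ 2) ∂(μ.comap (↑)) := by
      rw [integral_subtype_comap (measurableSet_singleton _).compl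
        fun x => f x * Real.exp (-‖x‖ ^ 2), restrict_compl_singleton]
    _ = ∫ p, f p.1 * (p.2.1 ^ k * Real.exp (-p.2.1 ^ 2))
          ∂μ.toSphere.prod (.volumeIoiPow (finrank ℝ E - 1)) := by
      rw [← μ.measurePreserving_homeomorphUnitSphereProd.integral_comp
        (Homeomorph.measurableEmbedding _)]
      refine integral_congr_ae (.of_forall fun x => ?_)
      have hx : 0 < ‖x.1‖ := norm_pos_iff.2 x.2
      have h1 : f x = ‖x.1‖ ^ k * f (‖x.1‖⁻¹ • x.1) := by
        rw [← hf _ hx, smul_inv_smul₀ hx.ne']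
      simp only [homeomorphUnitSphereProd_apply_snd_coe, homeomorphUnitSphereProd_apply_fst_coe]
      rw [h1]; ring
    _ = (∫ v : sphere (0 : E) 1, f v ∂μ.toSphere)
          * ∫ r : Ioi (0 : ℝ), r.1 ^ k * Real.exp (-r.1 ^ 2)
              ∂.volumeIoiPow (finrank ℝ E - 1) :=
      integral_prod_mul (fun v : sphere (0 : E) 1 => f v)
        (fun r : Ioi (0 : ℝ) => r.1 ^ k * Real.exp (-r.1 ^ 2))
    _ = _ := by
      rw [← hrad]
      congr 1
      simp only [Measure.volumeIoiPow, ENNReal.ofReal]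
      rw [integral_withDensity_eq_integral_smul,
        integral_subtype_comap measurableSet_Ioi
          fun a => Real.toNNReal (a ^ (finrank ℝ E - 1)) • (a ^ k * Real.exp (-a ^ 2)),
        setIntegral_congr_fun measurableSet_Ioi fun x hx => ?_]
      · rw [NNReal.smul_def, Real.coe_toNNReal _ (pow_nonneg hx.out.le _), smul_eq_mul]
      · exact (measurable_subtype_coe.pow_const _).real_toNNReal

theorem integral_gaussian :
    ∫ x : E, Real.exp (-‖x‖ ^ 2) ∂lebesgue E = Real.pi ^ ((finrank ℝ E : ℝ) / 2) := by
  have h := GaussianFourier.integral_rexp_neg_mul_sq_norm (V := E) one_pos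
  simp only [neg_mul, one_mul, div_one] at h
  exact h

theorem toSphere_real_univ [Nontrivial E] :
    (lebesgue E).toSphere.real univ * (1 / 2 * Real.Gamma ((finrank ℝ E : ℝ) / 2))
      = Real.pi ^ ((finrank ℝ E : ℝ) / 2) := by
  have h := integral_mul_gaussian_eq_toSphere (E := E) 0 (f := fun _ => 1) (by simp)
  simp only [one_mul, integral_gaussian, integral_const, smul_eq_mul, mul_one, add_zero] at h
  exact h.symm

/-- Spherical averages of positively homogeneous functions are Gaussian integrals. -/
theorem integral_uniformSphere_mul [Nontrivial E] (k : ℕ) {f : E → ℝ}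
    (hf : ∀ r : ℝ, 0 < r → ∀ x, f (r • x) = r ^ k * f x) :
    (∫ v, f v ∂uniformSphere E)
        * (Real.pi ^ ((finrank ℝ E : ℝ) / 2) * Real.Gamma (((finrank ℝ E + k : ℕ) : ℝ) / 2))
      = Real.Gamma ((finrank ℝ E : ℝ) / 2) * ∫ x, f x * Real.exp (-‖x‖ ^ 2) ∂lebesgue E := by
  have hu : (lebesgue E).toSphere.real univ ≠ 0 :=
    (measureReal_ne_zero_iff).2 (Measure.measure_univ_ne_zero.2 (Measure.toSphere_ne_zero _))
  rw [integral_uniformSphere, integral_mul_gaussian_eq_toSphere k hf, ← toSphere_real_univ]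
  field_simp

theorem integral_norm_mul_gaussian [Nontrivial E] :
    Real.Gamma ((finrank ℝ E : ℝ) / 2) * ∫ x : E, ‖x‖ * Real.exp (-‖x‖ ^ 2) ∂lebesgue E
      = Real.pi ^ ((finrank ℝ E : ℝ) / 2) * Real.Gamma (((finrank ℝ E : ℝ) + 1) / 2) := by
  rw [← integral_uniformSphere_mul (E := E) 1 (f := fun x => ‖x‖)
    (fun r hr x => by rw [norm_smul, Real.norm_of_nonneg hr.le, pow_one])]
  simp

/-- Splitting off the coordinate along a unit vector preserves Lebesgue measure. -/
theorem measurePreserving_smul_add_orthogonal {e : E} (he : ‖e‖ = 1) :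
    MeasurePreserving (fun p : ℝ × (Submodule.span ℝ {e})ᗮ => p.1 • e + (p.2 : E))
      (volume.prod (lebesgue _)) (lebesgue E) := by
  set K := Submodule.span ℝ {e}
  have h1 : MeasurePreserving (LinearIsometryEquiv.toSpanUnitSingleton (𝕜 := ℝ) e he)
      volume (lebesgue K) := LinearIsometryEquiv.measurePreserving _
  have h2 : MeasurePreserving (@WithLp.toLp 2 (K × Kᗮ)) ((lebesgue K).prod (lebesgue Kᗮ))
      (lebesgue _) := WithLp.volume_preserving_toLp K Kᗮ
  have h3 : MeasurePreserving K.orthogonalDecomposition.symm (lebesgue _) (lebesgue E) :=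
    LinearIsometryEquiv.measurePreserving _
  convert! h3.comp (h2.comp (h1.prod (MeasurePreserving.id (lebesgue Kᗮ)))) using 1

theorem measurableEmbedding_smul_add_orthogonal {e : E} (he : ‖e‖ = 1) :
    MeasurableEmbedding (fun p : ℝ × (Submodule.span ℝ {e})ᗮ => p.1 • e + (p.2 : E)) := by
  set K := Submodule.span ℝ {e}
  let g : ℝ × Kᗮ ≃ᵐ E :=
    ((LinearIsometryEquiv.toSpanUnitSingleton (𝕜 := ℝ) e he).toMeasurableEquiv.prodCongr
      (MeasurableEquiv.refl Kᗮ)).trans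
      ((MeasurableEquiv.toLp 2 _).trans K.orthogonalDecomposition.symm.toMeasurableEquiv)
  exact g.measurableEmbedding

theorem integral_abs_mul_exp_neg_sq : ∫ t : ℝ, |t| * Real.exp (-t ^ 2) = 1 := by
  have h := integral_comp_abs (f := fun t : ℝ => t * Real.exp (-t ^ 2))
  simp only [sq_abs] at h
  rw [h]
  have h2 := integral_rpow_mul_exp_neg_rpow (p := 2) (q := 1) two_pos (by norm_num)
  simp only [Real.rpow_one, Real.rpow_two] at h2
  rw [h2]
  norm_num

theorem integral_exp_neg_sq : ∫ t : ℝ, Real.exp (-t ^ 2) = √Real.pi := by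
  simpa using _root_.integral_gaussian 1

theorem integral_abs_inner_mul_gaussian {e : E} (he : ‖e‖ = 1) :
    ∫ x, |⟪e, x⟫| * Real.exp (-‖x‖ ^ 2) ∂lebesgue E
      = Real.pi ^ (((finrank ℝ E : ℝ) - 1) / 2) := by
  rw [← (measurePreserving_smul_add_orthogonal he).integral_comp
    (measurableEmbedding_smul_add_orthogonal he)]
  simp only [norm_smul_add_orthogonal_sq he, inner_smul_add_orthogonal he, neg_add, Real.exp_add,
    ← mul_assoc]
  rw [integral_prod_mul (fun t : ℝ => |t| * Real.exp (-t ^ 2)) (fun y => Real.exp (-‖y‖ ^ 2)),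
    integral_abs_mul_exp_neg_sq, integral_gaussian, one_mul, ← finrank_orthogonal_span he]
  push_cast
  ring_nf

/-- The square root is the norm of the component orthogonal to `e`, so the Gaussian integral factors
and the `e`-axis contributes only `√π`. -/
theorem integral_sqrt_mul_gaussian {e : E} (he : ‖e‖ = 1) :
    ∫ x, √(‖x‖ ^ 2 - ⟪e, x⟫ ^ 2) * Real.exp (-‖x‖ ^ 2) ∂lebesgue E
      = √Real.pi * ∫ y : (Submodule.span ℝ {e})ᗮ, ‖y‖ * Real.exp (-‖y‖ ^ 2) ∂lebesgue _ := by
  rw [← (measurePreserving_smul_add_orthogonal he).integral_comp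
    (measurableEmbedding_smul_add_orthogonal he), ← integral_exp_neg_sq,
    ← integral_prod_mul (fun t : ℝ => Real.exp (-t ^ 2)) (fun y => ‖y‖ * Real.exp (-‖y‖ ^ 2))]
  refine integral_congr_ae (.of_forall fun p => ?_)
  simp only [norm_smul_add_orthogonal_sq he, inner_smul_add_orthogonal he, neg_add, Real.exp_add,
    add_sub_cancel_left, Real.sqrt_sq (norm_nonneg _)]
  ring

/-- The mean of `|⟪e, v⟫|` over the unit sphere of an `m`-dimensional space. -/
def meanAbsCoord (m : ℕ) : ℝ :=
  Real.Gamma ((m : ℝ) / 2) / (√Real.pi * Real.Gamma (((m : ℝ) + 1) / 2))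

theorem integral_uniformSphere_abs_inner_unit [Nontrivial E] {e : E} (he : ‖e‖ = 1) :
    ∫ v : sphere (0 : E) 1, |⟪e, (v : E)⟫| ∂uniformSphere E = meanAbsCoord (finrank ℝ E) := by
  have h := integral_uniformSphere_mul (E := E) 1 (f := fun x => |⟪e, x⟫|)
    (fun r hr x => by simp [inner_smul_right, abs_mul, abs_of_pos hr])
  rw [integral_abs_inner_mul_gaussian he, sub_div, Real.rpow_sub Real.pi_pos,
    ← Real.sqrt_eq_rpow] at h
  have hG : 0 < Real.Gamma (((finrank ℝ E : ℝ) + 1) / 2) := Real.Gamma_pos_of_pos (by positivity)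
  have hp : 0 < Real.pi ^ ((finrank ℝ E : ℝ) / 2) := by positivity
  have hs : 0 < √Real.pi := by positivity
  push_cast at h
  rw [meanAbsCoord, eq_div_iff (by positivity)]
  field_simp at h
  linear_combination h

theorem integral_uniformSphere_abs_inner [Nontrivial E] (w : E) :
    ∫ v : sphere (0 : E) 1, |⟪w, (v : E)⟫| ∂uniformSphere E
      = ‖w‖ * meanAbsCoord (finrank ℝ E) := by
  rcases eq_or_ne w 0 with rfl | hw
  · simp
  have hw' : 0 < ‖w‖ := norm_pos_iff.2 hw
  rw [← integral_uniformSphere_abs_inner_unit (e := ‖w‖⁻¹ • w) (by simp [norm_smul, hw'.ne']),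
    ← integral_const_mul]
  refine integral_congr_ae (.of_forall fun v => ?_)
  simp only [inner_smul_left, abs_mul]
  simp [hw'.ne']

/-- This is why mean width and volume have the same expectation: the constant from averaging inside
the hyperplane is absorbed when the hyperplane itself is averaged. It compares the degree-one
Gaussian moment on `E` with the first moment of the norm on `e^⊥`; the dimension bound keeps `e^⊥`
nontrivial. -/
theorem integral_uniformSphere_sqrt {e : E} (he : ‖e‖ = 1) (hE : 2 ≤ finrank ℝ E) :
    (∫ v : sphere (0 : E) 1, √(1 - ⟪e, (v : E)⟫ ^ 2) ∂uniformSphere E)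
        * meanAbsCoord (finrank ℝ E - 1)
      = meanAbsCoord (finrank ℝ E) := by
  have hF := finrank_orthogonal_span he
  have hEF : (finrank ℝ E : ℝ) = finrank ℝ (Submodule.span ℝ {e})ᗮ + 1 := by
    exact_mod_cast hF.symm
  have : Nontrivial E := nontrivial_of_finrank_pos (R := ℝ) (by omega)
  have hFpos : 0 < finrank ℝ (Submodule.span ℝ {e})ᗮ := by omega
  have : Nontrivial (Submodule.span ℝ {e})ᗮ := nontrivial_of_finrank_pos (R := ℝ) hFpos
  -- The degree-one homogeneous extension of the integrand on the sphere.
  have h := integral_uniformSphere_mul (E := E) 1 (f := fun x => √(‖x‖ ^ 2 - ⟪e, x⟫ ^ 2))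
    (fun r hr x => by
      rw [norm_smul, Real.norm_of_nonneg hr.le, inner_smul_right, mul_pow, mul_pow, ← mul_sub,
        Real.sqrt_mul (by positivity), Real.sqrt_sq hr.le, pow_one])
  have h2 := integral_norm_mul_gaussian (E := (Submodule.span ℝ {e})ᗮ)
  rw [integral_sqrt_mul_gaussian he] at h
  simp only [norm_eq_of_mem_sphere, one_pow] at h
  rw [show finrank ℝ E - 1 = finrank ℝ (Submodule.span ℝ {e})ᗮ by omega, meanAbsCoord,
    meanAbsCoord]
  set J := ∫ y : (Submodule.span ℝ {e})ᗮ, ‖y‖ * Real.exp (-‖y‖ ^ 2) ∂lebesgue _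
  set I := ∫ v : sphere (0 : E) 1, √(1 - ⟪e, (v : E)⟫ ^ 2) ∂uniformSphere E
  push_cast at h
  rw [hEF] at h ⊢
  set m : ℝ := (finrank ℝ (Submodule.span ℝ {e})ᗮ : ℝ)
  have hm : 0 < m := Nat.cast_pos.2 hFpos
  rw [add_div m 1 2, Real.rpow_add Real.pi_pos, ← Real.sqrt_eq_rpow, ← add_div] at h
  have hG0 : 0 < Real.Gamma (m / 2) := Real.Gamma_pos_of_pos (by positivity)
  have hG1 : 0 < Real.Gamma ((m + 1) / 2) := Real.Gamma_pos_of_pos (by positivity)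
  have hG2 : 0 < Real.Gamma ((m + 1 + 1) / 2) := Real.Gamma_pos_of_pos (by positivity)
  have hp : 0 < Real.pi ^ (m / 2) := by positivity
  have hs : 0 < √Real.pi := by positivity
  rw [mul_div_assoc', div_eq_div_iff (by positivity) (by positivity)]
  have h3 : I * (Real.pi ^ (m / 2) * Real.Gamma ((m + 1 + 1) / 2))
      = Real.Gamma ((m + 1) / 2) * J := by
    refine mul_left_cancel₀ hs.ne' ?_
    linear_combination h
  refine mul_left_cancel₀ hp.ne' ?_
  linear_combination √Real.pi * Real.Gamma (m / 2) * h3 + √Real.pi * Real.Gamma ((m + 1) / 2) * h2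

end SphereAverages

/-! ### Mean width of the projected cube and its extrema -/

section MeanWidth

theorem smul_add_orthogonalProjectionOnto {E : Type*} [NormedAddCommGroup E]
    [InnerProductSpace ℝ E] {e : E} (he : ‖e‖ = 1) (x : E) :
    ⟪e, x⟫ • e + ((Submodule.span ℝ {e})ᗮ.orthogonalProjectionOnto x : E) = x := by
  rw [Submodule.orthogonalProjectionOnto_orthogonal]
  simp [Submodule.starProjection_unit_singleton ℝ he]

variable {n : ℕ} (u : Sph n)

theorem norm_sph : ‖(u : EuclideanSpace ℝ (Fin n))‖ = 1 := norm_eq_of_mem_sphere u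

theorem sum_sq_sph : ∑ i, (u : EuclideanSpace ℝ (Fin n)) i ^ 2 = 1 := by
  rw [← EuclideanSpace.real_norm_sq_eq, norm_sph, one_pow]

theorem abs_sph_le_one (i : Fin n) : |(u : EuclideanSpace ℝ (Fin n)) i| ≤ 1 := by
  have h := PiLp.norm_apply_le (u : EuclideanSpace ℝ (Fin n)) i
  rwa [norm_sph, Real.norm_eq_abs] at h

theorem sq_sph_le_one (i : Fin n) : (u : EuclideanSpace ℝ (Fin n)) i ^ 2 ≤ 1 :=
  (sq_le_one_iff_abs_le_one _).2 (abs_sph_le_one u i)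

theorem inner_single_sph (i : Fin n) (x : EuclideanSpace ℝ (Fin n)) :
    ⟪EuclideanSpace.single i (1 : ℝ), x⟫ = x i := by
  simp [EuclideanSpace.inner_single_left]

theorem finrank_hyperplane : finrank ℝ (hyperplane u) = n - 1 := by
  have h : finrank ℝ (hyperplane u) + 1 = _ := finrank_orthogonal_span (norm_sph u)
  rw [finrank_euclideanSpace_fin] at h
  omega

theorem norm_orthogonalProjectionOnto_single (i : Fin n) :
    ‖(hyperplane u).orthogonalProjectionOnto (EuclideanSpace.single i (1 : ℝ))‖
      = √(1 - (u : EuclideanSpace ℝ (Fin n)) i ^ 2) := by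
  have h := norm_smul_add_orthogonal_sq (norm_sph u)
    ⟪(u : EuclideanSpace ℝ (Fin n)), EuclideanSpace.single i (1 : ℝ)⟫
    ((hyperplane u).orthogonalProjectionOnto (EuclideanSpace.single i (1 : ℝ)))
  rw [smul_add_orthogonalProjectionOnto (norm_sph u), real_inner_comm, inner_single_sph] at h
  rw [eq_comm, Real.sqrt_eq_iff_eq_sq (by linarith [sq_sph_le_one u i]) (norm_nonneg _)]
  simp only [PiLp.norm_single, norm_one, one_pow] at h
  linarith

theorem inner_image_projectedCube (v : hyperplane u) :
    (fun x => ⟪v, x⟫) '' projectedCube u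
      = (fun x : EuclideanSpace ℝ (Fin n) => ∑ i, (v : EuclideanSpace ℝ (Fin n)) i * x i)
        '' cube n := by
  rw [projectedCube, image_image]
  refine image_congr fun x _ => ?_
  rw [Submodule.inner_orthogonalProjectionOnto_eq_of_mem_left, PiLp.inner_apply]
  simp [mul_comm]

theorem width_projectedCube (v : hyperplane u) :
    width (projectedCube u) v = ∑ i, |(v : EuclideanSpace ℝ (Fin n)) i| := by
  set w := (v : EuclideanSpace ℝ (Fin n))
  have hb : ∀ x ∈ cube n, |∑ i, w i * x i| ≤ (∑ i, |w i|) / 2 := by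
    intro x hx
    refine (Finset.abs_sum_le_sum_abs _ _).trans ?_
    rw [Finset.sum_div]
    refine Finset.sum_le_sum fun i _ => ?_
    rw [abs_mul, div_eq_mul_one_div]
    exact mul_le_mul_of_nonneg_left (hx i) (abs_nonneg _)
  have hs : ∀ x : ℝ, |(SignType.sign x : ℝ) / 2| ≤ 1 / 2 := by
    intro x
    rcases lt_trichotomy x 0 with h | h | h <;> simp [h, abs_div]
  have hsum : ∑ i, w i * ((SignType.sign (w i) : ℝ) / 2) = (∑ i, |w i|) / 2 := by
    rw [Finset.sum_div]
    refine Finset.sum_congr rfl fun i _ => ?_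
    rw [mul_div_assoc', self_mul_sign]
  -- The maximiser is half the sign vector of `w`; coordinates with `w i = 0` get the value `0`,
  -- which is harmless.
  have hmax : IsGreatest ((fun x : EuclideanSpace ℝ (Fin n) => ∑ i, w i * x i) '' cube n)
      ((∑ i, |w i|) / 2) := by
    refine ⟨⟨WithLp.toLp 2 fun i => (SignType.sign (w i) : ℝ) / 2, fun i => hs _, hsum⟩, ?_⟩
    rintro _ ⟨x, hx, rfl⟩
    exact (abs_le.1 (hb x hx)).2
  have hmin : IsLeast ((fun x : EuclideanSpace ℝ (Fin n) => ∑ i, w i * x i) '' cube n)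
      (-((∑ i, |w i|) / 2)) := by
    refine ⟨⟨WithLp.toLp 2 fun i => -((SignType.sign (w i) : ℝ) / 2), fun i => ?_, ?_⟩, ?_⟩
    · simpa only [abs_neg] using hs (w i)
    · simp only [mul_neg, Finset.sum_neg_distrib, hsum]
    rintro _ ⟨x, hx, rfl⟩
    exact (abs_le.1 (hb x hx)).1
  rw [width, inner_image_projectedCube, hmax.csSup_eq, hmin.csInf_eq]
  ring

theorem mw_eq (hn : 2 ≤ n) :
    mw u = meanAbsCoord (n - 1) * ∑ i, √(1 - (u : EuclideanSpace ℝ (Fin n)) i ^ 2) := by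
  have : Nontrivial (hyperplane u) :=
    nontrivial_of_finrank_pos (R := ℝ) (by rw [finrank_hyperplane]; omega)
  simp only [mw, meanWidth, width_projectedCube]
  rw [integral_finsetSum, Finset.mul_sum]
  · refine Finset.sum_congr rfl fun i _ => ?_
    rw [← norm_orthogonalProjectionOnto_single, ← finrank_hyperplane u, mul_comm,
      ← integral_uniformSphere_abs_inner]
    refine integral_congr_ae (.of_forall fun v => ?_)
    simp only
    rw [Submodule.inner_orthogonalProjectionOnto_eq_of_mem_right, inner_single_sph]
  · intro i _
    refine Continuous.integrable_of_hasCompactSupport (by fun_prop) ?_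
    exact HasCompactSupport.of_compactSpace _

theorem meanAbsCoord_three : meanAbsCoord 3 = 1 / 2 := by
  have h1 : Real.Gamma ((3 : ℝ) / 2) = 1 / 2 * √Real.pi := by
    rw [show (3 : ℝ) / 2 = 1 / 2 + 1 by norm_num, Real.Gamma_add_one (by norm_num),
      Real.Gamma_one_half_eq]
  have h2 : Real.Gamma (((3 : ℝ) + 1) / 2) = 1 := by norm_num
  have hs : 0 < √Real.pi := Real.sqrt_pos.2 Real.pi_pos
  rw [meanAbsCoord]
  push_cast
  rw [h1, h2]
  field_simp

theorem meanAbsCoord_four : meanAbsCoord 4 = 4 / (3 * Real.pi) := by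
  have h1 : Real.Gamma ((4 : ℝ) / 2) = 1 := by norm_num
  have h2 : Real.Gamma (((4 : ℝ) + 1) / 2) = 3 / 4 * √Real.pi := by
    rw [show ((4 : ℝ) + 1) / 2 = 1 / 2 + 1 + 1 by norm_num, Real.Gamma_add_one (by norm_num),
      Real.Gamma_add_one (by norm_num), Real.Gamma_one_half_eq]
    ring
  have hs : 0 < √Real.pi := Real.sqrt_pos.2 Real.pi_pos
  rw [meanAbsCoord]
  push_cast
  rw [h1, h2]
  field_simp
  rw [Real.sq_sqrt Real.pi_pos.le]

theorem integrable_uniformSphere [Nontrivial (EuclideanSpace ℝ (Fin n))] {f : Sph n → ℝ}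
    (hf : Continuous f) : Integrable f (uniformSphere (EuclideanSpace ℝ (Fin n))) :=
  hf.integrable_of_hasCompactSupport (HasCompactSupport.of_compactSpace _)

theorem nontrivial_euclideanSpace (hn : 2 ≤ n) : Nontrivial (EuclideanSpace ℝ (Fin n)) :=
  nontrivial_of_finrank_pos (R := ℝ) (by rw [finrank_euclideanSpace_fin]; omega)

theorem expect_mw (hn : 2 ≤ n) : expect (fun u : Sph n => mw u) = n * meanAbsCoord n := by
  have := nontrivial_euclideanSpace hn
  simp only [expect, mw_eq _ hn]
  rw [integral_const_mul, integral_finsetSum _ fun i _ => integrable_uniformSphere (by fun_prop),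
    Finset.mul_sum]
  have h : ∀ i : Fin n, meanAbsCoord (n - 1)
      * ∫ v : Sph n, √(1 - (v : EuclideanSpace ℝ (Fin n)) i ^ 2)
          ∂uniformSphere (EuclideanSpace ℝ (Fin n)) = meanAbsCoord n := by
    intro i
    have h := integral_uniformSphere_sqrt (e := EuclideanSpace.single i (1 : ℝ)) (by simp)
      (by rw [finrank_euclideanSpace_fin]; exact hn)
    simp only [inner_single_sph, finrank_euclideanSpace_fin] at h
    rw [mul_comm, h]
  simp [h]

theorem expect_sum_abs (hn : 2 ≤ n) :
    expect (fun u : Sph n => ∑ i, |(u : EuclideanSpace ℝ (Fin n)) i|) = n * meanAbsCoord n := by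
  have := nontrivial_euclideanSpace hn
  simp only [expect]
  rw [integral_finsetSum _ fun i _ => integrable_uniformSphere (by fun_prop)]
  have h : ∀ i : Fin n, ∫ v : Sph n, |(v : EuclideanSpace ℝ (Fin n)) i|
          ∂uniformSphere (EuclideanSpace ℝ (Fin n)) = meanAbsCoord n := by
    intro i
    have h := integral_uniformSphere_abs_inner_unit (e := EuclideanSpace.single i (1 : ℝ)) (by simp)
    simpa only [inner_single_sph, finrank_euclideanSpace_fin] using h
  simp [h]

theorem mw_four (u : Sph 4) :
    mw u = 1 / 2 * ∑ i, √(1 - (u : EuclideanSpace ℝ (Fin 4)) i ^ 2) := by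
  rw [mw_eq u (by norm_num), meanAbsCoord_three]

theorem isGreatest_mw_four : IsGreatest (range fun u : Sph 4 => mw u) √3 := by
  constructor
  -- The main diagonal is the equality case of Cauchy–Schwarz.
  · refine ⟨⟨WithLp.toLp 2 fun _ => 1 / 2, ?_⟩, ?_⟩
    · simp [EuclideanSpace.norm_eq]
      norm_num
    · simp only [mw_four, Fin.sum_univ_four]
      rw [show (1 : ℝ) - (1 / 2) ^ 2 = 3 / 2 ^ 2 by norm_num, Real.sqrt_div (by norm_num),
        Real.sqrt_sq (by norm_num)]
      ring
  · rintro _ ⟨u, rfl⟩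
    simp only [mw_four]
    have h := sq_sum_le_card_mul_sum_sq (s := (Finset.univ : Finset (Fin 4)))
      (f := fun i => √(1 - (u : EuclideanSpace ℝ (Fin 4)) i ^ 2))
    have h2 : ∑ i, √(1 - (u : EuclideanSpace ℝ (Fin 4)) i ^ 2) ^ 2 = 3 := by
      simp_rw [Real.sq_sqrt (sub_nonneg.2 (sq_sph_le_one u _))]
      rw [Finset.sum_sub_distrib, sum_sq_sph]
      norm_num
    rw [h2] at h
    simp only [Finset.card_univ, Fintype.card_fin] at h
    refine Real.le_sqrt_of_sq_le ?_
    rw [mul_pow]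
    push_cast at h
    linarith

theorem isLeast_mw_four : IsLeast (range fun u : Sph 4 => mw u) (3 / 2) := by
  constructor
  -- Along a coordinate axis every `1 - u i ^ 2` is `0` or `1`, the equality case of `t ≤ √t`.
  · refine ⟨⟨EuclideanSpace.single 0 1, by simp⟩, ?_⟩
    simp [mw_four, Fin.sum_univ_four]
    norm_num
  · rintro _ ⟨u, rfl⟩
    simp only [mw_four]
    have h : ∑ i, (1 - (u : EuclideanSpace ℝ (Fin 4)) i ^ 2)
        ≤ ∑ i, √(1 - (u : EuclideanSpace ℝ (Fin 4)) i ^ 2) := by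
      refine Finset.sum_le_sum fun i _ => Real.le_sqrt_of_sq_le ?_
      nlinarith [sq_sph_le_one u i, sq_nonneg ((u : EuclideanSpace ℝ (Fin 4)) i)]
    rw [Finset.sum_sub_distrib, sum_sq_sph] at h
    norm_num at h ⊢
    linarith

end MeanWidth

/-! ### Volume of the projected cube -/

section Volume

open Filter Topology

theorem lebesgue_box {n : ℕ} (a b : Fin n → ℝ) :
    lebesgue (EuclideanSpace ℝ (Fin n)) {x | ∀ i, x i ∈ Icc (a i) (b i)}
      = ∏ i, ENNReal.ofReal (b i - a i) := by
  have h : MeasurePreserving (@WithLp.toLp 2 (Fin n → ℝ)) volume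
      (lebesgue (EuclideanSpace ℝ (Fin n))) := PiLp.volume_preserving_toLp (Fin n)
  rw [← h.measure_preimage_emb (MeasurableEquiv.toLp 2 (Fin n → ℝ)).measurableEmbedding]
  have : WithLp.toLp 2 ⁻¹' {x : EuclideanSpace ℝ (Fin n) | ∀ i, x i ∈ Icc (a i) (b i)}
      = univ.pi fun i => Icc (a i) (b i) := by
    ext x; simp only [mem_preimage, mem_ofPred_eq, mem_univ_pi]
  rw [this, volume_pi_pi]
  simp

theorem convex_cube (n : ℕ) : Convex ℝ (cube n) := by
  have : cube n = ⋂ i, {x : EuclideanSpace ℝ (Fin n) | |x i| ≤ 1 / 2} := by ext; simp [cube]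
  rw [this]
  refine convex_iInter fun i => ?_
  have h : Convex ℝ {x : ℝ | |x| ≤ 1 / 2} := by
    have : {x : ℝ | |x| ≤ 1 / 2} = Icc (-(1 / 2)) (1 / 2) := by ext x; exact abs_le (a := x)
    rw [this]
    exact convex_Icc _ _
  exact h.linear_preimage (EuclideanSpace.proj i : EuclideanSpace ℝ (Fin n) →L[ℝ] ℝ).toLinearMap

theorem isClosed_cube (n : ℕ) : IsClosed (cube n) := by
  simp only [cube, ofPred_forall]
  exact isClosed_iInter fun i => isClosed_le (by fun_prop) continuous_const

theorem isCompact_cube (n : ℕ) : IsCompact (cube n) := by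
  refine Metric.isCompact_of_isClosed_isBounded (isClosed_cube n) ?_
  refine (Metric.isBounded_closedBall (x := (0 : EuclideanSpace ℝ (Fin n))) (r := n)).subset ?_
  intro x hx
  rw [mem_closedBall_zero_iff, EuclideanSpace.norm_eq]
  refine Real.sqrt_le_iff.2 ⟨Nat.cast_nonneg _, ?_⟩
  have h : ∑ i, ‖x i‖ ^ 2 ≤ ∑ _i : Fin n, (1 : ℝ) := by
    refine Finset.sum_le_sum fun i _ => ?_
    have := hx i
    rw [Real.norm_eq_abs]
    nlinarith [abs_nonneg (x i)]
  refine h.trans ?_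
  rw [Finset.sum_const, Finset.card_univ, Fintype.card_fin, nsmul_eq_mul, mul_one]
  rcases Nat.eq_zero_or_pos n with rfl | hn
  · simp
  · have : (1 : ℝ) ≤ n := by exact_mod_cast hn
    nlinarith

variable {n : ℕ} (u : Sph n)

/-- The cube meets its translate in a box with sides `1 - t |u i|`; the bound `t ≤ 1` keeps these
nonnegative. -/
theorem lebesgue_cube_diff {t : ℝ} (ht0 : 0 ≤ t) (ht1 : t ≤ 1) :
    lebesgue (EuclideanSpace ℝ (Fin n))
        (cube n \ (fun x => x + t • (u : EuclideanSpace ℝ (Fin n))) ⁻¹' cube n)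
      = ENNReal.ofReal (1 - ∏ i, (1 - t * |(u : EuclideanSpace ℝ (Fin n)) i|)) := by
  set w := (u : EuclideanSpace ℝ (Fin n))
  have hcube : lebesgue (EuclideanSpace ℝ (Fin n)) (cube n) = 1 := by
    have h := lebesgue_box (fun _ : Fin n => -(1 / 2 : ℝ)) (fun _ => 1 / 2)
    simp only [sub_neg_eq_add, add_halves, ENNReal.ofReal_one, Finset.prod_const_one] at h
    rw [← h]
    congr 1
    ext x
    exact forall_congr' fun i => abs_le
  have hinter : cube n ∩ (fun x => x + t • w) ⁻¹' cube n
      = {x | ∀ i, x i ∈ Icc (-(1 / 2) + max 0 (-(t * w i))) (1 / 2 - max 0 (t * w i))} := by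
    ext x
    simp only [cube, mem_inter_iff, mem_ofPred_eq, mem_preimage, ← forall_and, mem_Icc, abs_le,
      PiLp.add_apply, PiLp.smul_apply, smul_eq_mul]
    refine forall_congr' fun i => ?_
    rcases max_cases (0 : ℝ) (-(t * w i)) with h1 | h1 <;>
      rcases max_cases (0 : ℝ) (t * w i) with h2 | h2 <;> rw [h1.1, h2.1] <;>
      constructor <;> rintro ⟨h3, h4⟩ <;> refine ⟨?_, ?_⟩ <;>
      first | linarith | (constructor <;> linarith)
  have hmeas : MeasurableSet ((fun x => x + t • w) ⁻¹' cube n) :=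
    (isClosed_cube n).measurableSet.preimage (by fun_prop)
  have hnn : ∀ i ∈ (Finset.univ : Finset (Fin n)), 0 ≤ 1 - t * |w i| := fun i _ => by
    nlinarith [abs_sph_le_one u i, abs_nonneg (w i)]
  have hsub := ENNReal.eq_sub_of_add_eq
    (measure_ne_top_of_subset inter_subset_left (isCompact_cube n).measure_ne_top)
    (measure_sdiff_add_inter (μ := lebesgue (EuclideanSpace ℝ (Fin n))) (cube n) hmeas)
  rw [hsub, hcube, hinter, lebesgue_box,
    ENNReal.ofReal_sub _ (Finset.prod_nonneg hnn), ENNReal.ofReal_one,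
    ENNReal.ofReal_prod_of_nonneg hnn]
  congr 1
  refine Finset.prod_congr rfl fun i _ => ?_
  congr 1
  have := max_zero_add_max_neg_zero_eq_abs_self (t * w i)
  rw [abs_mul, abs_of_nonneg ht0] at this
  rw [max_comm 0, max_comm 0]
  linarith

/-- The intersection of the cube with a line in direction `u`, in arc-length coordinates. -/
def fibre (y : hyperplane u) : Set ℝ :=
  {s | s • (u : EuclideanSpace ℝ (Fin n)) + (y : EuclideanSpace ℝ (Fin n)) ∈ cube n}

theorem mem_projectedCube_iff (y : hyperplane u) :
    y ∈ projectedCube u ↔ (fibre u y).Nonempty := by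
  constructor
  · rintro ⟨x, hx, rfl⟩
    refine ⟨⟪(u : EuclideanSpace ℝ (Fin n)), x⟫, ?_⟩
    rw [fibre, mem_ofPred_eq, smul_add_orthogonalProjectionOnto (norm_sph u)]
    exact hx
  · rintro ⟨s, hs⟩
    refine ⟨_, hs, ?_⟩
    simp only [map_add, map_smul, Submodule.orthogonalProjectionOnto_mem_subspace_eq_self]
    rw [Submodule.orthogonalProjectionOnto_orthogonalComplement_singleton_eq_zero, smul_zero,
      zero_add]

theorem isCompact_projectedCube : IsCompact (projectedCube u) :=
  (isCompact_cube n).image (hyperplane u).orthogonalProjectionOnto.continuous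

theorem convex_projectedCube : Convex ℝ (projectedCube u) :=
  (convex_cube n).linear_image (hyperplane u).orthogonalProjectionOnto.toLinearMap

theorem exists_fibre_eq_Icc {y : hyperplane u} (hy : y ∈ projectedCube u) :
    ∃ a b, a ≤ b ∧ fibre u y = Icc a b := by
  have hne := (mem_projectedCube_iff u y).1 hy
  have hclosed : IsClosed (fibre u y) := (isClosed_cube n).preimage (by fun_prop)
  have hbdd : Bornology.IsBounded (fibre u y) := by
    obtain ⟨R, hR⟩ := (isCompact_cube n).isBounded.subset_closedBall 0
    refine (Metric.isBounded_closedBall (x := (0 : ℝ)) (r := R)).subset fun s hs => ?_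
    have h1 := hR hs
    rw [mem_closedBall_zero_iff] at h1 ⊢
    have h2 := norm_smul_add_orthogonal_sq (norm_sph u) s y
    have h3 : |s| ^ 2 ≤ ‖s • (u : EuclideanSpace ℝ (Fin n)) + (y : EuclideanSpace ℝ (Fin n))‖ ^ 2 := by
      rw [h2, sq_abs]; nlinarith [sq_nonneg ‖y‖]
    exact (abs_le_of_sq_le_sq' (by rwa [sq_abs] at h3) (norm_nonneg _) |> abs_le.2).trans h1
  have hconv : Convex ℝ (fibre u y) := by
    intro s hs t ht a b ha hb hab
    have := convex_cube n hs ht ha hb hab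
    refine (congrArg (· ∈ cube n) ?_).mp this
    rw [smul_add, smul_add, add_add_add_comm, ← add_smul, hab, one_smul, smul_smul, smul_smul,
      ← add_smul, smul_eq_mul, smul_eq_mul]
  have hcompact : IsCompact (fibre u y) := Metric.isCompact_of_isClosed_isBounded hclosed hbdd
  have h := eq_Icc_of_connected_compact ⟨hne, hconv.isPreconnected⟩ hcompact
  exact ⟨_, _, csInf_le_csSup hne hcompact.bddBelow hcompact.bddAbove, h⟩

/-- For some `r > 1` the point `r • y` still lies in the projection. Shrinking a cube point above it
by `1 / r` gives a point above `y` whose coordinates are at most `1 / (2 r)`, which leaves room to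
move along `u` because `|u i| ≤ 1`. -/
theorem exists_fibre_eq_Icc_of_mem_interior {y : hyperplane u}
    (hy : y ∈ interior (projectedCube u)) : ∃ a b, a < b ∧ fibre u y = Icc a b := by
  obtain ⟨a, b, -, h⟩ := exists_fibre_eq_Icc u (interior_subset hy)
  refine ⟨a, b, ?_, h⟩
  have hcont : Tendsto (fun r : ℝ => r • y) (𝓝[>] 1) (𝓝 y) := by
    have : Continuous fun r : ℝ => r • y := by fun_prop
    simpa using (this.tendsto 1).mono_left nhdsWithin_le_nhds
  obtain ⟨r, hrP, hr⟩ := ((hcont.eventually (mem_interior_iff_mem_nhds.1 hy)).and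
    self_mem_nhdsWithin).exists
  have hr : 1 < r := hr
  have hr0 : 0 < r := by linarith
  obtain ⟨s, hs⟩ := (mem_projectedCube_iff u _).1 hrP
  set w := (u : EuclideanSpace ℝ (Fin n))
  have hmem : ∀ d : ℝ, |d| ≤ 1 / 2 - 1 / (2 * r) → s / r + d ∈ fibre u y := by
    intro d hd i
    have h1 := hs i
    have h2 := abs_sph_le_one u i
    simp only [PiLp.add_apply, PiLp.smul_apply, smul_eq_mul, Submodule.coe_smul] at h1 ⊢
    have h3 : (s / r + d) * w i + (y : EuclideanSpace ℝ (Fin n)) i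
        = (s * w i + r * (y : EuclideanSpace ℝ (Fin n)) i) / r + d * w i := by
      field_simp
      ring
    rw [h3]
    refine (abs_add_le _ _).trans ?_
    rw [abs_div, abs_mul, abs_of_pos hr0]
    have h4 : |s * w i + r * (y : EuclideanSpace ℝ (Fin n)) i| / r ≤ 1 / 2 / r :=
      div_le_div_of_nonneg_right h1 hr0.le
    have h5 : |d| * |w i| ≤ |d| := mul_le_of_le_one_right (abs_nonneg _) h2
    rw [div_div] at h4
    linarith
  have hδ : 0 < 1 / 2 - 1 / (2 * r) := by
    rw [sub_pos]
    exact one_div_lt_one_div_of_lt two_pos (by linarith)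
  have m1 := hmem 0 (by simpa using hδ.le)
  have m2 := hmem (1 / 2 - 1 / (2 * r)) (abs_of_pos hδ).le
  rw [h] at m1 m2
  linarith [m1.1, m2.2]

theorem lebesgue_cube_diff_eq_lintegral (t : ℝ) :
    lebesgue (EuclideanSpace ℝ (Fin n))
        (cube n \ (fun x => x + t • (u : EuclideanSpace ℝ (Fin n))) ⁻¹' cube n)
      = ∫⁻ y, volume (fibre u y \ (fun s => s + t) ⁻¹' fibre u y) ∂lebesgue (hyperplane u) := by
  set w := (u : EuclideanSpace ℝ (Fin n))
  have hmeas : MeasurableSet (cube n \ (fun x => x + t • w) ⁻¹' cube n) :=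
    (isClosed_cube n).measurableSet.diff ((isClosed_cube n).measurableSet.preimage (by fun_prop))
  have hmp := measurePreserving_smul_add_orthogonal (norm_sph u)
  rw [← hmp.measure_preimage hmeas.nullMeasurableSet,
    Measure.prod_apply_symm (hmp.measurable hmeas)]
  refine lintegral_congr fun y => ?_
  congr 1
  ext s
  simp only [fibre, mem_preimage, Set.mem_sdiff, mem_ofPred_eq, add_smul]
  rw [add_right_comm]

theorem measurable_volume_fibre_diff (t : ℝ) :
    Measurable fun y => volume (fibre u y \ (fun s => s + t) ⁻¹' fibre u y) := by
  have hm : Measurable fun p : ℝ × hyperplane u =>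
      p.1 • (u : EuclideanSpace ℝ (Fin n)) + (p.2 : EuclideanSpace ℝ (Fin n)) := by fun_prop
  have h1 : MeasurableSet {p : ℝ × hyperplane u | p.1 ∈ fibre u p.2} :=
    hm (isClosed_cube n).measurableSet
  have h2 : MeasurableSet {p : ℝ × hyperplane u | p.1 + t ∈ fibre u p.2} :=
    h1.preimage (f := fun p : ℝ × hyperplane u => (p.1 + t, p.2)) (by fun_prop)
  exact measurable_measure_prodMk_right (h1.diff h2)

theorem volume_Icc_diff_le (a b t : ℝ) :
    volume (Icc a b \ (fun s => s + t) ⁻¹' Icc a b) ≤ ENNReal.ofReal |t| := by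
  rcases le_total 0 t with ht | ht
  · refine (measure_mono (t := Ioc (b - t) b) ?_).trans ?_
    · rintro s ⟨h1, h2⟩
      refine ⟨?_, h1.2⟩
      by_contra! h
      exact h2 ⟨by linarith [h1.1], by linarith⟩
    · simp [abs_of_nonneg ht]
  · refine (measure_mono (t := Ico a (a - t)) ?_).trans ?_
    · rintro s ⟨h1, h2⟩
      refine ⟨h1.1, ?_⟩
      by_contra! h
      exact h2 ⟨by linarith, by linarith [h1.2]⟩
    · simp [abs_of_nonpos ht]

theorem volume_Icc_diff {a b t : ℝ} (ht : 0 ≤ t) (htb : t ≤ b - a) :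
    volume (Icc a b \ (fun s => s + t) ⁻¹' Icc a b) = ENNReal.ofReal t := by
  have : Icc a b \ (fun s => s + t) ⁻¹' Icc a b = Ioc (b - t) b := by
    ext s
    simp only [Set.mem_sdiff, mem_preimage, mem_Icc, mem_Ioc, not_and, not_le]
    constructor
    · rintro ⟨h1, h2⟩
      exact ⟨by linarith [h2 (by linarith)], h1.2⟩
    · rintro ⟨h1, h2⟩
      exact ⟨⟨by linarith, h2⟩, fun _ => by linarith⟩
  rw [this, Real.volume_Ioc, sub_sub_cancel]

theorem tendsto_one_sub_prod_div (w : Fin n → ℝ) :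
    Tendsto (fun t : ℝ => (1 - ∏ i, (1 - t * w i)) / t) (𝓝[>] 0) (𝓝 (∑ i, w i)) := by
  have h : HasDerivAt (fun t : ℝ => 1 - ∏ i, (1 - t * w i)) (∑ i, w i) 0 := by
    have h1 : ∀ i ∈ (Finset.univ : Finset (Fin n)),
        HasDerivAt (fun t : ℝ => 1 - t * w i) (-w i) 0 := fun i _ => by
      simpa using ((hasDerivAt_id (0 : ℝ)).mul_const (w i)).const_sub 1
    simpa using (HasDerivAt.fun_finsetProd h1).const_sub 1
  have h2 := h.tendsto_slope_zero_right
  simp only [zero_add, zero_mul, sub_zero, Finset.prod_const_one, sub_self, smul_eq_mul] at h2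
  simpa only [div_eq_inv_mul] using h2

/-- The volume of the projection of the cube along `u` is the `ℓ¹`-norm of `u`. -/
theorem vl_eq : vl u = ∑ i, |(u : EuclideanSpace ℝ (Fin n)) i| := by
  set P := projectedCube u
  have hP : MeasurableSet P := (isCompact_projectedCube u).isClosed.measurableSet
  -- A sequence of shifts for dominated convergence; the `+ 1` keeps them within `(0, 1]`, as
  -- `lebesgue_cube_diff` needs.
  let τ : ℕ → ℝ := fun k => 1 / ((k : ℝ) + 1)
  have hτ0 : ∀ k, 0 < τ k := fun k => by positivity
  have hτ1 : ∀ k, τ k ≤ 1 := fun k => (div_le_one (by positivity)).2 (by linarith [k.cast_nonneg (α := ℝ)])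
  have hτ : Tendsto τ atTop (𝓝[>] 0) :=
    tendsto_nhdsWithin_iff.2 ⟨tendsto_one_div_add_atTop_nhds_zero_nat, .of_forall hτ0⟩
  let φ : ℕ → hyperplane u → ENNReal := fun k y =>
    volume (fibre u y \ (fun s => s + τ k) ⁻¹' fibre u y) / ENNReal.ofReal (τ k)
  have hout : ∀ k y, y ∉ P → φ k y = 0 := by
    intro k y hy
    have : fibre u y = ∅ := by
      rwa [mem_projectedCube_iff, not_nonempty_iff_eq_empty] at hy
    simp [φ, this]
  have hlim : Tendsto (fun k => ∫⁻ y, φ k y ∂lebesgue (hyperplane u)) atTop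
      (𝓝 (∫⁻ y, P.indicator 1 y ∂lebesgue (hyperplane u))) := by
    refine tendsto_lintegral_of_dominated_convergence (P.indicator 1)
      (fun k => (measurable_volume_fibre_diff u _).div_const _) (fun k => .of_forall fun y => ?_)
      ?_ ?_
    · by_cases hy : y ∈ P
      · obtain ⟨a, b, -, h⟩ := exists_fibre_eq_Icc u hy
        simp only [φ, indicator_of_mem hy, Pi.one_apply, h]
        refine ENNReal.div_le_of_le_mul ?_
        rw [one_mul]
        refine (volume_Icc_diff_le _ _ _).trans ?_
        rw [abs_of_pos (hτ0 k)]
      · simp [hout k y hy]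
    · rw [lintegral_indicator_one hP]
      exact (isCompact_projectedCube u).measure_ne_top
    -- Boundary fibres may degenerate to points, but the frontier of a convex set is null.
    · have hfr : ∀ᵐ y ∂lebesgue (hyperplane u), y ∉ frontier P :=
        measure_eq_zero_iff_ae_notMem.1 ((convex_projectedCube u).addHaar_frontier _)
      filter_upwards [hfr] with y hy
      by_cases hyP : y ∈ P
      · have hyi : y ∈ interior P := by
          by_contra hni
          exact hy ⟨subset_closure hyP, hni⟩
        obtain ⟨a, b, hab, h⟩ := exists_fibre_eq_Icc_of_mem_interior u hyi
        refine tendsto_const_nhds.congr' ?_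
        have : ∀ᶠ k in atTop, τ k < b - a :=
          (hτ.mono_right nhdsWithin_le_nhds).eventually_lt_const (sub_pos.2 hab)
        filter_upwards [this] with k hk
        simp only [φ, indicator_of_mem hyP, Pi.one_apply, h, volume_Icc_diff (hτ0 k).le hk.le]
        rw [ENNReal.div_self (by simpa using hτ0 k) ENNReal.ofReal_ne_top]
      · simp [hout _ y hyP, hyP]
  have hval : ∀ k, ∫⁻ y, φ k y ∂lebesgue (hyperplane u)
      = ENNReal.ofReal ((1 - ∏ i, (1 - τ k * |(u : EuclideanSpace ℝ (Fin n)) i|)) / τ k) := by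
    intro k
    simp only [φ, div_eq_mul_inv]
    rw [lintegral_mul_const _ (measurable_volume_fibre_diff u _), ← lebesgue_cube_diff_eq_lintegral,
      lebesgue_cube_diff u (hτ0 k).le (hτ1 k), ← div_eq_mul_inv, ← div_eq_mul_inv,
      ENNReal.ofReal_div_of_pos (hτ0 k)]
  simp only [hval] at hlim
  have hlim2 := ENNReal.tendsto_ofReal ((tendsto_one_sub_prod_div
    fun i => |(u : EuclideanSpace ℝ (Fin n)) i|).comp hτ)
  have := tendsto_nhds_unique hlim hlim2
  rw [lintegral_indicator_one hP] at this
  rw [vl, this, ENNReal.toReal_ofReal (Finset.sum_nonneg fun i _ => abs_nonneg _)]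

end Volume

/-! ### Two coordinates on the 3-sphere are uniform on the disk -/

section DiskMarginal

open scoped ENNReal

theorem lintegral_gaussian {E : Type*} [NormedAddCommGroup E] [InnerProductSpace ℝ E]
    [FiniteDimensional ℝ E] [MeasurableSpace E] [BorelSpace E] :
    ∫⁻ x : E, ENNReal.ofReal (Real.exp (-‖x‖ ^ 2)) ∂lebesgue E
      = ENNReal.ofReal (Real.pi ^ ((finrank ℝ E : ℝ) / 2)) := by
  rw [← integral_gaussian, ofReal_integral_eq_lintegral_ofReal]
  -- The integral of a non-integrable function is `0` by convention, so a nonzero value proves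
  -- integrability.
  · refine Integrable.of_integral_ne_zero ?_
    rw [integral_gaussian]
    positivity
  · exact .of_forall fun x => (Real.exp_pos _).le

/-- Averages of scale-invariant functions over the sphere as Gaussian integrals. -/
theorem lintegral_mul_gaussian_eq_uniformSphere {E : Type*} [NormedAddCommGroup E]
    [InnerProductSpace ℝ E] [FiniteDimensional ℝ E] [MeasurableSpace E] [BorelSpace E]
    [Nontrivial E] {g : E → ℝ≥0∞} (hgm : Measurable g)
    (hg : ∀ r : ℝ, 0 < r → ∀ x, g (r • x) = g x) :
    ∫⁻ x, g x * ENNReal.ofReal (Real.exp (-‖x‖ ^ 2)) ∂lebesgue E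
      = ENNReal.ofReal (Real.pi ^ ((finrank ℝ E : ℝ) / 2)) * ∫⁻ v, g v ∂uniformSphere E := by
  set μ := lebesgue E
  have key : ∀ f : E → ℝ≥0∞, Measurable f → (∀ r : ℝ, 0 < r → ∀ x, f (r • x) = f x) →
      ∫⁻ x, f x * ENNReal.ofReal (Real.exp (-‖x‖ ^ 2)) ∂μ
        = (∫⁻ v : sphere (0 : E) 1, f v ∂μ.toSphere) * ∫⁻ r : Ioi (0 : ℝ),
            ENNReal.ofReal (Real.exp (-r.1 ^ 2)) ∂.volumeIoiPow (finrank ℝ E - 1) := by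
    intro f hfm hf
    rw [← lintegral_prod_mul (by fun_prop) (by fun_prop),
      ← μ.measurePreserving_homeomorphUnitSphereProd.lintegral_comp_emb
        (Homeomorph.measurableEmbedding _)]
    rw [← restrict_compl_singleton (μ := μ) 0,
      ← lintegral_subtype_comap (measurableSet_singleton _).compl, restrict_compl_singleton]
    refine lintegral_congr fun x => ?_
    have hx : 0 < ‖x.1‖ := norm_pos_iff.2 x.2
    simp only [homeomorphUnitSphereProd_apply_snd_coe, homeomorphUnitSphereProd_apply_fst_coe]
    rw [hf _ (inv_pos.2 hx)]
  -- The constant function identifies the radial factor, which is common to all scale-invariant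
  -- integrands.
  have h1 := key 1 measurable_one (by simp)
  simp only [Pi.one_apply, one_mul, lintegral_one, μ, lintegral_gaussian] at h1
  rw [key g hgm hg, h1, uniformSphere, lintegral_smul_measure, smul_eq_mul]
  set σ := μ.toSphere
  have hσ0 : σ univ ≠ 0 := Measure.measure_univ_ne_zero.2 (Measure.toSphere_ne_zero _)
  have hσt : σ univ ≠ ⊤ := measure_ne_top _ _
  calc _ = (σ univ * (σ univ)⁻¹) * ((∫⁻ v : sphere (0 : E) 1, g v ∂σ) * _) := by
        rw [ENNReal.mul_inv_cancel hσ0 hσt, one_mul]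
    _ = _ := by ring

/-- Polar coordinates with `s = r ^ 2`: the angle gives `2 π` and `r dr = ds / 2`. That the squared
radius has constant density is what makes the marginal on the disk uniform. -/
theorem lintegral_comp_sq_add_sq {K : ℝ → ℝ≥0∞} (hK : Measurable K) :
    ∫⁻ q : ℝ × ℝ, K (q.1 ^ 2 + q.2 ^ 2)
      = ENNReal.ofReal Real.pi * ∫⁻ s in Ioi (0 : ℝ), K s := by
  have hsq : ∀ p : ℝ × ℝ,
      (polarCoord.symm p).1 ^ 2 + (polarCoord.symm p).2 ^ 2 = p.1 ^ 2 := fun p => by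
    rw [polarCoord_symm_apply]
    linear_combination p.1 ^ 2 * Real.cos_sq_add_sin_sq p.2
  have himg : (fun r : ℝ => r ^ 2) '' Ioi 0 = Ioi 0 := by
    ext s
    constructor
    · rintro ⟨r, hr, rfl⟩
      exact pow_pos (mem_Ioi.1 hr) 2
    · intro hs
      exact ⟨√s, Real.sqrt_pos.2 hs, Real.sq_sqrt (le_of_lt hs)⟩
  have hcv := lintegral_image_eq_lintegral_abs_deriv_mul (s := Ioi (0 : ℝ)) measurableSet_Ioi
    (f := fun r => r ^ 2) (f' := fun r => 2 * r)
    (fun r _ => by simpa using (hasDerivAt_pow 2 r).hasDerivWithinAt)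
    (fun a ha b hb h => (pow_left_inj₀ (le_of_lt ha) (le_of_lt hb) two_ne_zero).1 h) K
  rw [himg] at hcv
  rw [← lintegral_comp_polarCoord_symm, hcv]
  simp only [hsq, smul_eq_mul]
  rw [polarCoord_target, Measure.volume_eq_prod, ← Measure.prod_restrict]
  have h2 : ∀ p : ℝ × ℝ, ENNReal.ofReal p.1 * K (p.1 ^ 2)
      = ENNReal.ofReal p.1 * K (p.1 ^ 2) * (fun _ => (1 : ℝ≥0∞)) p.2 := fun p => by simp
  rw [lintegral_congr h2,
    lintegral_prod_mul (f := fun r : ℝ => ENNReal.ofReal r * K (r ^ 2))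
      (g := fun _ : ℝ => (1 : ℝ≥0∞)) (by fun_prop)
    (by fun_prop), lintegral_one, Measure.restrict_apply_univ, Real.volume_Ioo, mul_comm,
    ← lintegral_const_mul _ (by fun_prop), ← lintegral_const_mul _ (by fun_prop)]
  refine setLIntegral_congr_fun measurableSet_Ioi fun r hr => ?_
  have hr : 0 < r := hr
  rw [← mul_assoc, ← mul_assoc, ← ENNReal.ofReal_mul (by linarith [Real.pi_pos]),
    ← ENNReal.ofReal_mul Real.pi_pos.le, abs_of_pos (by positivity)]
  congr 2
  ring

/-- The open unit disk, as a subset of `ℝ × ℝ`. -/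
def disk : Set (ℝ × ℝ) := {p | p.1 ^ 2 + p.2 ^ 2 < 1}

theorem measurableSet_disk : MeasurableSet disk :=
  measurableSet_lt (by fun_prop) measurable_const

theorem lintegral_comp_smul_plane (F : ℝ × ℝ → ℝ≥0∞) {w : ℝ} (hw : 0 < w) :
    ∫⁻ p, F ((√w)⁻¹ • p) = ENNReal.ofReal w * ∫⁻ p, F p := by
  have hc : (√w)⁻¹ ≠ 0 := inv_ne_zero (Real.sqrt_pos.2 hw).ne'
  have he : MeasurableEmbedding fun p : ℝ × ℝ => (√w)⁻¹ • p :=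
    (Homeomorph.smulOfNeZero _ hc).measurableEmbedding
  rw [← he.lintegral_map, Measure.map_addHaar_smul _ hc, lintegral_smul_measure, smul_eq_mul]
  congr 2
  rw [finrank_prod, finrank_self, inv_pow, Real.sq_sqrt hw.le, inv_inv, abs_of_pos hw]

theorem lintegral_mul_exp_neg :
    ∫⁻ w in Ioi (0 : ℝ), ENNReal.ofReal w * ENNReal.ofReal (Real.exp (-w)) = 1 := by
  have h : ∫ w in Ioi (0 : ℝ), w * Real.exp (-w) = 1 := by
    have h := integral_rpow_mul_exp_neg_rpow (p := 1) (q := 1) one_pos (by norm_num)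
    simp only [Real.rpow_one] at h
    rw [h]
    norm_num
  rw [← ENNReal.ofReal_one, ← h, ofReal_integral_eq_lintegral_ofReal]
  · refine setLIntegral_congr_fun measurableSet_Ioi fun w hw => ?_
    rw [ENNReal.ofReal_mul (le_of_lt hw)]
  · exact Integrable.of_integral_ne_zero (by rw [h]; exact one_ne_zero)
  · filter_upwards [ae_restrict_mem measurableSet_Ioi] with w hw
    exact mul_nonneg (le_of_lt hw) (Real.exp_pos _).le

/-- Substitute `w = |p| ^ 2 + s` and integrate over `p` first: it fills the disk of radius `√w`, and
rescaling to the unit disk costs a factor `w`. What remains is `∫ w e^{-w} = 1`. -/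
theorem lintegral_lintegral_gaussian_shift {h : ℝ × ℝ → ℝ≥0∞} (hh : Measurable h) :
    ∫⁻ p : ℝ × ℝ, ∫⁻ s in Ioi (0 : ℝ), h ((√(p.1 ^ 2 + p.2 ^ 2 + s))⁻¹ • p)
        * ENNReal.ofReal (Real.exp (-(p.1 ^ 2 + p.2 ^ 2 + s)))
      = ∫⁻ p in disk, h p := by
  let H : ℝ × ℝ → ℝ → ℝ≥0∞ := fun p w =>
    {z : (ℝ × ℝ) × ℝ | z.1.1 ^ 2 + z.1.2 ^ 2 < z.2}.indicator
      (fun z => h ((√z.2)⁻¹ • z.1) * ENNReal.ofReal (Real.exp (-z.2))) (p, w)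
  have hHm : Measurable (Function.uncurry H) :=
    Measurable.indicator (by fun_prop) (measurableSet_lt (by fun_prop) (by fun_prop))
  have h1 : ∀ p : ℝ × ℝ, ∫⁻ s in Ioi (0 : ℝ), h ((√(p.1 ^ 2 + p.2 ^ 2 + s))⁻¹ • p)
        * ENNReal.ofReal (Real.exp (-(p.1 ^ 2 + p.2 ^ 2 + s))) = ∫⁻ w, H p w := by
    intro p
    rw [← lintegral_add_left_eq_self (H p) (p.1 ^ 2 + p.2 ^ 2),
      ← lintegral_indicator measurableSet_Ioi]
    refine lintegral_congr fun s => ?_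
    by_cases hs : 0 < s <;> simp [H, indicator, hs]
  have h2 : ∀ w : ℝ, ∫⁻ p, H p w = (Ioi (0 : ℝ)).indicator
      (fun w => ENNReal.ofReal w * ENNReal.ofReal (Real.exp (-w)) * ∫⁻ p in disk, h p) w := by
    intro w
    by_cases hw : 0 < w
    · rw [indicator_of_mem (mem_Ioi.2 hw)]
      have h3 : ∀ p : ℝ × ℝ, H p w
          = disk.indicator h ((√w)⁻¹ • p) * ENNReal.ofReal (Real.exp (-w)) := by
        intro p
        have : (√w)⁻¹ • p ∈ disk ↔ p.1 ^ 2 + p.2 ^ 2 < w := by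
          simp only [disk, mem_ofPred_eq, Prod.smul_fst, Prod.smul_snd, smul_eq_mul, mul_pow,
            inv_pow, Real.sq_sqrt hw.le, ← mul_add]
          rw [inv_mul_lt_iff₀ hw, mul_one]
        by_cases hp : p.1 ^ 2 + p.2 ^ 2 < w <;> simp [H, indicator, hp, this]
      simp only [h3]
      rw [lintegral_mul_const (f := fun p => disk.indicator h ((√w)⁻¹ • p)) _
          ((hh.indicator measurableSet_disk).comp (measurable_const_smul _)),
        lintegral_comp_smul_plane _ hw, lintegral_indicator measurableSet_disk]
      ring
    · rw [indicator_of_notMem (by simpa using hw)]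
      have h3 : ∀ p : ℝ × ℝ, H p w = 0 := by
        intro p
        have : ¬ (p.1 ^ 2 + p.2 ^ 2 < w) := by nlinarith [sq_nonneg p.1, sq_nonneg p.2]
        simp [H, indicator, this]
      simp [h3]
  simp only [h1]
  rw [lintegral_lintegral_swap hHm.aemeasurable]
  simp only [h2]
  rw [lintegral_indicator measurableSet_Ioi, lintegral_mul_const _ (by fun_prop),
    lintegral_mul_exp_neg, one_mul]

/-- Grouping the four coordinates of `ℝ⁴` into two pairs. -/
def pairs (e : Fin 2 ⊕ Fin 2 ≃ Fin 4) (x : EuclideanSpace ℝ (Fin 4)) : (ℝ × ℝ) × (ℝ × ℝ) :=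
  ((x (e (.inl 0)), x (e (.inl 1))), (x (e (.inr 0)), x (e (.inr 1))))

theorem measurePreserving_pairs (e : Fin 2 ⊕ Fin 2 ≃ Fin 4) :
    MeasurePreserving (pairs e) (lebesgue _) volume := by
  have h1 : MeasurePreserving (@WithLp.ofLp 2 (Fin 4 → ℝ))
      (lebesgue (EuclideanSpace ℝ (Fin 4))) volume := PiLp.volume_preserving_ofLp (Fin 4)
  have h2 := (volume_measurePreserving_piCongrLeft (fun _ : Fin 4 => ℝ) e).symm
  have h3 := volume_measurePreserving_sumPiEquivProdPi fun _ : Fin 2 ⊕ Fin 2 => ℝ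
  have h4 := (volume_preserving_finTwoArrow ℝ).prod (volume_preserving_finTwoArrow ℝ)
  exact h4.comp (h3.comp (h2.comp h1))

theorem norm_sq_eq_pairs (e : Fin 2 ⊕ Fin 2 ≃ Fin 4) (x : EuclideanSpace ℝ (Fin 4)) :
    ‖x‖ ^ 2 = (pairs e x).1.1 ^ 2 + (pairs e x).1.2 ^ 2
      + ((pairs e x).2.1 ^ 2 + (pairs e x).2.2 ^ 2) := by
  rw [EuclideanSpace.real_norm_sq_eq, ← e.sum_comp]
  simp [Fintype.sum_sum_type, pairs]

/-- Any two distinct coordinates of a uniform random point of `S³` are uniform on the disk. -/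
theorem map_uniformSphere_four {i j : Fin 4} (hij : i ≠ j) :
    (uniformSphere (EuclideanSpace ℝ (Fin 4))).map
        (fun u : Sph 4 =>
          (((u : EuclideanSpace ℝ (Fin 4)) i, (u : EuclideanSpace ℝ (Fin 4)) j) : ℝ × ℝ))
      = (ENNReal.ofReal Real.pi)⁻¹ • volume.restrict disk := by
  obtain ⟨e, hei, hej⟩ : ∃ e : Fin 2 ⊕ Fin 2 ≃ Fin 4, e (.inl 0) = i ∧ e (.inl 1) = j := by
    -- The first swap sends `0` to `i`; the second sends the image of `1` to `j` and fixes `i`,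
    -- since `i ≠ j`.
    refine ⟨finSumFinEquiv.trans ((Equiv.swap 0 i).trans
      (Equiv.swap (Equiv.swap 0 i 1) j)), ?_, ?_⟩ <;> revert i j <;> decide
  have : Nontrivial (EuclideanSpace ℝ (Fin 4)) := nontrivial_euclideanSpace (by norm_num)
  refine Measure.ext_of_lintegral _ fun h hh => ?_
  rw [lintegral_map hh (by fun_prop), lintegral_smul_measure, smul_eq_mul]
  have hG := lintegral_mul_gaussian_eq_uniformSphere (E := EuclideanSpace ℝ (Fin 4))
    (g := fun x => h (‖x‖⁻¹ • (x i, x j))) (by fun_prop) (by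
      intro r hr x
      congr 1
      rw [norm_smul, Real.norm_of_nonneg hr.le]
      ext <;> simp <;> field_simp)
  simp only [norm_eq_of_mem_sphere, inv_one, one_smul, finrank_euclideanSpace_fin] at hG
  have hL : ∫⁻ x : EuclideanSpace ℝ (Fin 4), h (‖x‖⁻¹ • (x i, x j))
      * ENNReal.ofReal (Real.exp (-‖x‖ ^ 2)) ∂lebesgue _
      = ENNReal.ofReal Real.pi * ∫⁻ p in disk, h p := by
    let Ψ : (ℝ × ℝ) → ℝ → ℝ≥0∞ := fun p s => h ((√(p.1 ^ 2 + p.2 ^ 2 + s))⁻¹ • p)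
        * ENNReal.ofReal (Real.exp (-(p.1 ^ 2 + p.2 ^ 2 + s)))
    have hΨ : Measurable (Function.uncurry Ψ) := by fun_prop
    have h1 : ∀ x : EuclideanSpace ℝ (Fin 4), h (‖x‖⁻¹ • (x i, x j))
        * ENNReal.ofReal (Real.exp (-‖x‖ ^ 2))
        = (fun z : (ℝ × ℝ) × (ℝ × ℝ) => Ψ z.1 (z.2.1 ^ 2 + z.2.2 ^ 2)) (pairs e x) := by
      intro x
      simp only [Ψ, ← norm_sq_eq_pairs, Real.sqrt_sq (norm_nonneg x)]
      simp only [pairs, hei, hej]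
    simp only [h1]
    have hΨ' : Measurable fun z : (ℝ × ℝ) × (ℝ × ℝ) => Ψ z.1 (z.2.1 ^ 2 + z.2.2 ^ 2) := by
      fun_prop
    rw [(measurePreserving_pairs e).lintegral_comp hΨ', Measure.volume_eq_prod,
      lintegral_prod _ hΨ'.aemeasurable]
    have h2 : ∀ p, ∫⁻ q : ℝ × ℝ, Ψ p (q.1 ^ 2 + q.2 ^ 2)
        = ENNReal.ofReal Real.pi * ∫⁻ s in Ioi (0 : ℝ), Ψ p s := fun p =>
      lintegral_comp_sq_add_sq (K := Ψ p) (by fun_prop)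
    simp only [h2]
    have hm : Measurable fun p => ∫⁻ s in Ioi (0 : ℝ), Ψ p s := hΨ.lintegral_prod_right'
    rw [lintegral_const_mul _ hm, lintegral_lintegral_gaussian_shift hh]
  rw [hL] at hG
  have hpi0 : ENNReal.ofReal Real.pi ≠ 0 := by simpa using Real.pi_pos
  have hpow : ENNReal.ofReal (Real.pi ^ (((4 : ℕ) : ℝ) / 2))
      = ENNReal.ofReal Real.pi * ENNReal.ofReal Real.pi := by
    rw [← ENNReal.ofReal_mul Real.pi_pos.le]
    norm_num [pow_two]
  rw [hpow, mul_assoc, ENNReal.mul_right_inj hpi0 ENNReal.ofReal_ne_top] at hG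
  rw [hG, ← mul_assoc, ENNReal.inv_mul_cancel hpi0 ENNReal.ofReal_ne_top, one_mul]

end DiskMarginal

/-! ### Second moments in dimension four -/

section SecondMoments

theorem abs_lt_one_of_mem_disk {p : ℝ × ℝ} (hp : p ∈ disk) : |p.1| < 1 ∧ |p.2| < 1 := by
  have hp : p.1 ^ 2 + p.2 ^ 2 < 1 := hp
  constructor <;> rw [← sq_lt_one_iff_abs_lt_one] <;> nlinarith [sq_nonneg p.1, sq_nonneg p.2]

theorem setIntegral_disk_of_even {G : ℝ → ℝ → ℝ} (hG : Continuous (Function.uncurry G)) :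
    ∫ p in disk, G |p.1| |p.2| = 4 * ∫ x in (0 : ℝ)..1, ∫ y in (0 : ℝ)..√(1 - x ^ 2), G x y := by
  have hGc : Continuous fun p : ℝ × ℝ => G |p.1| |p.2| :=
    hG.comp (f := fun p : ℝ × ℝ => (|p.1|, |p.2|)) (by fun_prop)
  have hsub : disk ⊆ Icc (-1) 1 ×ˢ Icc (-1) 1 := fun p hp =>
    ⟨abs_le.1 (abs_lt_one_of_mem_disk hp).1.le, abs_le.1 (abs_lt_one_of_mem_disk hp).2.le⟩
  have hint : IntegrableOn (fun p : ℝ × ℝ => G |p.1| |p.2|) disk :=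
    (hGc.continuousOn.integrableOn_compact (isCompact_Icc.prod isCompact_Icc)).mono_set hsub
  let J : ℝ → ℝ := fun x => 2 * ∫ y in (0 : ℝ)..√(1 - x ^ 2), G x y
  have hinner : ∀ x : ℝ, ∫ y, disk.indicator (fun p => G |p.1| |p.2|) (x, y) = J |x| := by
    intro x
    have h1 : ∀ y : ℝ, disk.indicator (fun p => G |p.1| |p.2|) (x, y)
        = (Iio √(1 - |x| ^ 2)).indicator (fun t => G |x| t) |y| := by
      intro y
      have : (x, y) ∈ disk ↔ |y| ∈ Iio √(1 - |x| ^ 2) := by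
        rw [mem_Iio, Real.lt_sqrt (abs_nonneg y), sq_abs, sq_abs, lt_sub_iff_add_lt, add_comm]
        rfl
      simp only [indicator, this]
    simp only [h1]
    rw [integral_comp_abs (f := (Iio √(1 - |x| ^ 2)).indicator fun t => G |x| t),
      setIntegral_indicator measurableSet_Iio, Ioi_inter_Iio]
    simp only [J]
    rw [intervalIntegral.integral_of_le (Real.sqrt_nonneg _), integral_Ioc_eq_integral_Ioo]
  rw [← integral_indicator measurableSet_disk, Measure.volume_eq_prod,
    integral_prod _ ((integrable_indicator_iff measurableSet_disk).2 hint)]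
  simp only [hinner]
  rw [integral_comp_abs (f := J)]
  -- Beyond `1` the upper limit is the square root of a negative number, which is `0` by convention.
  have hzero : ∀ x ∈ Ioi (0 : ℝ), x ∉ Ioc (0 : ℝ) 1 → J x = 0 := by
    intro x hx hx'
    have hx1 : 1 < x := by
      by_contra! h
      exact hx' ⟨hx, h⟩
    have : √(1 - x ^ 2) = 0 := Real.sqrt_eq_zero_of_nonpos (by nlinarith)
    simp [J, this]
  rw [setIntegral_eq_of_subset_of_forall_sdiff_eq_zero
    measurableSet_Ioi Ioc_subset_Ioi_self (fun x hx => hzero x hx.1 hx.2),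
    ← intervalIntegral.integral_of_le zero_le_one, intervalIntegral.integral_const_mul]
  ring

theorem expect_four_of_even {i j : Fin 4} (hij : i ≠ j) {G : ℝ → ℝ → ℝ}
    (hG : Continuous (Function.uncurry G)) :
    expect (fun u : Sph 4 => G |(u : EuclideanSpace ℝ (Fin 4)) i|
        |(u : EuclideanSpace ℝ (Fin 4)) j|)
      = 4 / Real.pi * ∫ x in (0 : ℝ)..1, ∫ y in (0 : ℝ)..√(1 - x ^ 2), G x y := by
  have hGc : Continuous fun p : ℝ × ℝ => G |p.1| |p.2| :=
    hG.comp (f := fun p : ℝ × ℝ => (|p.1|, |p.2|)) (by fun_prop)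
  have h := integral_map (μ := uniformSphere (EuclideanSpace ℝ (Fin 4)))
    (φ := fun u : Sph 4 =>
      (((u : EuclideanSpace ℝ (Fin 4)) i, (u : EuclideanSpace ℝ (Fin 4)) j) : ℝ × ℝ))
    (by fun_prop) (f := fun p : ℝ × ℝ => G |p.1| |p.2|) hGc.aestronglyMeasurable
  rw [expect, ← h, map_uniformSphere_four hij, integral_smul_measure,
    setIntegral_disk_of_even hG, ENNReal.toReal_inv, ENNReal.toReal_ofReal Real.pi_pos.le,
    smul_eq_mul]
  ring

theorem hasDerivAt_sqrt_one_sub_sq {x : ℝ} (h0 : -1 < x) (h1 : x < 1) :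
    HasDerivAt (fun x => √(1 - x ^ 2)) (-x / √(1 - x ^ 2)) x := by
  have hx : 1 - x ^ 2 ≠ 0 := by nlinarith
  have h := (((hasDerivAt_pow 2 x).const_sub 1).sqrt hx)
  convert! h using 1
  have : √(1 - x ^ 2) ≠ 0 := (Real.sqrt_pos.2 (by nlinarith)).ne'
  field_simp
  norm_num
  ring

theorem integral_sqrt_one_sub_sq {c : ℝ} (h0 : 0 ≤ c) (h1 : c ≤ 1) :
    ∫ y in (0 : ℝ)..c, √(1 - y ^ 2) = (Real.arcsin c + c * √(1 - c ^ 2)) / 2 := by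
  have h := intervalIntegral.integral_eq_sub_of_hasDerivAt_of_le h0
    (f := fun y => (Real.arcsin y + y * √(1 - y ^ 2)) / 2) (f' := fun y => √(1 - y ^ 2))
    (by fun_prop) (fun y hy => ?_) (Continuous.intervalIntegrable (by fun_prop) _ _)
  · rw [h]; simp
  · have hy0 : -1 < y := by linarith [hy.1]
    have hy1 : y < 1 := by linarith [hy.2]
    have hs : 0 < √(1 - y ^ 2) := Real.sqrt_pos.2 (by nlinarith)
    have hd := ((Real.hasDerivAt_arcsin hy0.ne' hy1.ne).add
      ((hasDerivAt_id y).mul (hasDerivAt_sqrt_one_sub_sq hy0 hy1))).div_const 2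
    convert! hd using 1
    have hsq := Real.sq_sqrt (show 0 ≤ 1 - y ^ 2 by nlinarith)
    simp only [id]
    field_simp
    linear_combination hsq

theorem integral_integral_sqrt_mul_sqrt :
    ∫ x in (0 : ℝ)..1, ∫ y in (0 : ℝ)..√(1 - x ^ 2), √(1 - x ^ 2) * √(1 - y ^ 2)
      = Real.pi ^ 2 / 32 + 1 / 4 := by
  have hinner : ∀ x ∈ uIcc (0 : ℝ) 1,
      ∫ y in (0 : ℝ)..√(1 - x ^ 2), √(1 - x ^ 2) * √(1 - y ^ 2)
        = √(1 - x ^ 2) * ((Real.arccos x + √(1 - x ^ 2) * x) / 2) := by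
    intro x hx
    rw [uIcc_of_le zero_le_one] at hx
    have hnn : 0 ≤ 1 - x ^ 2 := by nlinarith [hx.1, hx.2]
    rw [intervalIntegral.integral_const_mul, integral_sqrt_one_sub_sq (Real.sqrt_nonneg _)
      (Real.sqrt_le_one.2 (by nlinarith)), ← Real.arccos_eq_arcsin hx.1, Real.sq_sqrt hnn,
      sub_sub_cancel, Real.sqrt_sq hx.1]
  rw [intervalIntegral.integral_congr hinner]
  have h := intervalIntegral.integral_eq_sub_of_hasDerivAt_of_le (zero_le_one (α := ℝ))
    -- Integration by parts: the first three terms form a primitive of `arccos x * √(1 - x ^ 2)`,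
    -- the last bracket one of `x * (1 - x ^ 2)`.
    (f := fun x => (-Real.arccos x ^ 2 / 4 + Real.arccos x * x * √(1 - x ^ 2) / 2
      + (2 * x ^ 2 - 1) / 8 + (x ^ 2 / 2 - x ^ 4 / 4)) / 2)
    (f' := fun x => √(1 - x ^ 2) * ((Real.arccos x + √(1 - x ^ 2) * x) / 2))
    (by fun_prop) (fun x hx => ?_) (Continuous.intervalIntegrable (by fun_prop) _ _)
  · rw [h]
    simp
    ring
  · have hx0 : -1 < x := by linarith [hx.1]
    have hs : 0 < √(1 - x ^ 2) := Real.sqrt_pos.2 (by nlinarith [hx.2])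
    have ha := Real.hasDerivAt_arccos hx0.ne' hx.2.ne
    have hd := (((((ha.pow 2).neg.div_const 4).add
      (((ha.mul (hasDerivAt_id x)).mul (hasDerivAt_sqrt_one_sub_sq hx0 hx.2)).div_const 2)).add
      ((((hasDerivAt_pow 2 x).const_mul 2).sub_const 1).div_const 8)).add
      (((hasDerivAt_pow 2 x).div_const 2).sub ((hasDerivAt_pow 4 x).div_const 4))).div_const 2
    convert! hd using 1
    have hsq := Real.sq_sqrt (show 0 ≤ 1 - x ^ 2 by nlinarith [hx.1, hx.2])
    simp only [id]
    set s := √(1 - x ^ 2)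
    set θ := Real.arccos x
    field_simp
    norm_num
    linear_combination (θ * 32 + s * x * 64) * hsq

theorem integral_integral_mul :
    ∫ x in (0 : ℝ)..1, ∫ y in (0 : ℝ)..√(1 - x ^ 2), x * y = 1 / 8 := by
  have hinner : ∀ x ∈ uIcc (0 : ℝ) 1,
      ∫ y in (0 : ℝ)..√(1 - x ^ 2), x * y = x / 2 - x ^ 3 / 2 := by
    intro x hx
    rw [uIcc_of_le zero_le_one] at hx
    rw [intervalIntegral.integral_const_mul, integral_id,
      Real.sq_sqrt (by nlinarith [hx.1, hx.2])]
    ring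
  rw [intervalIntegral.integral_congr hinner, intervalIntegral.integral_sub
    (Continuous.intervalIntegrable (by fun_prop) _ _)
    (Continuous.intervalIntegrable (by fun_prop) _ _),
    intervalIntegral.integral_div, intervalIntegral.integral_div, integral_id, integral_pow]
  norm_num

theorem expect_sqrt_mul_sqrt {i j : Fin 4} (hij : i ≠ j) :
    expect (fun u : Sph 4 => √(1 - (u : EuclideanSpace ℝ (Fin 4)) i ^ 2)
        * √(1 - (u : EuclideanSpace ℝ (Fin 4)) j ^ 2))
      = Real.pi / 8 + 1 / Real.pi := by
  have h := expect_four_of_even hij (G := fun x y => √(1 - x ^ 2) * √(1 - y ^ 2))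
    (by unfold Function.uncurry; fun_prop)
  simp only [sq_abs] at h
  rw [h, integral_integral_sqrt_mul_sqrt]
  have := Real.pi_pos
  field_simp
  ring

theorem expect_abs_mul_abs {i j : Fin 4} (hij : i ≠ j) :
    expect (fun u : Sph 4 => |(u : EuclideanSpace ℝ (Fin 4)) i|
        * |(u : EuclideanSpace ℝ (Fin 4)) j|) = 1 / (2 * Real.pi) := by
  rw [expect_four_of_even hij (G := fun x y => x * y) (by unfold Function.uncurry; fun_prop),
    integral_integral_mul]
  have := Real.pi_pos
  field_simp
  norm_num

/-- Expanding the square leaves a constant diagonal and `4 * 3 = 12` ordered off-diagonal pairs. -/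
theorem expect_sum_sq {f : Fin 4 → Sph 4 → ℝ} (hf : ∀ i, Continuous (f i)) {d K : ℝ}
    (hd : ∀ u, ∑ i, f i u ^ 2 = d)
    (hK : ∀ i j, i ≠ j → expect (fun u => f i u * f j u) = K) :
    expect (fun u => (∑ i, f i u) ^ 2) = d + 12 * K := by
  have : Nontrivial (EuclideanSpace ℝ (Fin 4)) := nontrivial_euclideanSpace (by norm_num)
  have h : ∀ u, (∑ i, f i u) ^ 2 = d + ∑ i, ∑ j ∈ Finset.univ.erase i, f i u * f j u := by
    intro u
    simp_rw [← Finset.mul_sum, Finset.sum_erase_eq_sub (Finset.mem_univ _), mul_sub]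
    rw [Finset.sum_sub_distrib, ← Finset.sum_mul, ← hd u]
    simp only [pow_two]
    ring
  have hint : ∀ i, ∀ j ∈ Finset.univ.erase i, Integrable (fun u => f i u * f j u)
      (uniformSphere (EuclideanSpace ℝ (Fin 4))) :=
    fun i j _ => integrable_uniformSphere ((hf i).mul (hf j))
  have hsum : ∀ i, ∑ j ∈ Finset.univ.erase i, expect (fun u => f i u * f j u) = 3 * K := by
    intro i
    rw [Finset.sum_congr rfl fun j hj => hK i j (Finset.ne_of_mem_erase hj).symm,
      Finset.sum_const, Finset.card_erase_of_mem (Finset.mem_univ _), Finset.card_univ,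
      Fintype.card_fin, nsmul_eq_mul]
    norm_num
  simp only [h, expect] at hsum ⊢
  rw [integral_add (integrable_const _) (integrable_finsetSum _ fun i _ =>
    integrable_finsetSum _ (hint i)), integral_finsetSum _ fun i _ =>
    integrable_finsetSum _ (hint i)]
  simp_rw [integral_finsetSum _ (hint _), hsum]
  simp
  ring

theorem expect_mw_sq :
    expect (fun u : Sph 4 => mw u ^ 2) = 3 * (1 / 4 + Real.pi / 8 + 1 / Real.pi) := by
  have h := expect_sum_sq
    (f := fun i u => √(1 - (u : EuclideanSpace ℝ (Fin 4)) i ^ 2)) (fun i => by fun_prop) (d := 3)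
    (fun u => by
      simp_rw [Real.sq_sqrt (sub_nonneg.2 (sq_sph_le_one u _))]
      rw [Finset.sum_sub_distrib, sum_sq_sph]
      norm_num)
    (fun i j hij => expect_sqrt_mul_sqrt hij)
  simp only [expect] at h ⊢
  simp only [mw_four, mul_pow]
  rw [integral_const_mul, h]
  ring

theorem expect_vl_sq : expect (fun u : Sph 4 => vl u ^ 2) = 1 + 6 / Real.pi := by
  simp only [vl_eq]
  rw [expect_sum_sq (d := 1) (fun i => by fun_prop)
    (fun u => by simp only [sq_abs]; exact sum_sq_sph u) (fun i j hij => expect_abs_mul_abs hij)]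
  have := Real.pi_pos
  field_simp
  ring

theorem second_moment_lt : 3 * (1 / 4 + Real.pi / 8 + 1 / Real.pi) < 1 + 6 / Real.pi := by
  have h1 := Real.pi_gt_three
  have h2 := Real.pi_lt_d2
  have h3 : 3 * (1 / 4 + Real.pi / 8 + 1 / Real.pi) = (3 / 4 + 3 * Real.pi / 8) + 3 / Real.pi := by
    ring
  have h4 : 6 / Real.pi = 3 / Real.pi + 3 / Real.pi := by ring
  -- The claim after cancelling `3 / π` and dividing by `3`; it amounts to `3 π ^ 2 - 2 π < 24`, for
  -- which `π < 3.15` suffices.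
  have h5 : Real.pi / 8 - 1 / 12 < 1 / Real.pi := by
    rw [lt_div_iff₀ Real.pi_pos]
    nlinarith
  have h6 : 3 / Real.pi = 3 * (1 / Real.pi) := by ring
  rw [h3, h4, h6]
  linarith

end SecondMoments

end CubeProjection

end

theorem mainTheorem3 :
    -- the mean width of the projected 4-cube, for every unit vector `u`
    (∀ u : CubeProjection.Sph 4,
      CubeProjection.mw u
        = 1 / 2 * ∑ i, Real.sqrt (1 - ((u : EuclideanSpace ℝ (Fin 4)) i) ^ 2)) ∧
    -- first moment
    CubeProjection.expect (fun u : CubeProjection.Sph 4 => CubeProjection.mw u)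
      = 16 / (3 * Real.pi) ∧
    CubeProjection.expect (fun u : CubeProjection.Sph 4 => CubeProjection.vl u)
      = 16 / (3 * Real.pi) ∧
    -- second moment, and comparison with the second moment of the volume
    CubeProjection.expect (fun u : CubeProjection.Sph 4 => CubeProjection.mw u ^ 2)
      = 3 * (1 / 4 + Real.pi / 8 + 1 / Real.pi) ∧
    CubeProjection.expect (fun u : CubeProjection.Sph 4 => CubeProjection.mw u ^ 2)
      < CubeProjection.expect (fun u : CubeProjection.Sph 4 => CubeProjection.vl u ^ 2) ∧
    CubeProjection.expect (fun u : CubeProjection.Sph 4 => CubeProjection.vl u ^ 2)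
      = 1 + 6 / Real.pi ∧
    -- extreme values
    IsGreatest (Set.range (fun u : CubeProjection.Sph 4 => CubeProjection.mw u))
      (Real.sqrt 3) ∧
    IsLeast (Set.range (fun u : CubeProjection.Sph 4 => CubeProjection.mw u)) (3 / 2) ∧
    -- first moment in every dimension
    (∀ n : ℕ, 2 ≤ n →
      CubeProjection.expect (fun u : CubeProjection.Sph n => CubeProjection.mw u)
        = (n : ℝ) / Real.sqrt Real.pi
            * (Real.Gamma ((n : ℝ) / 2) / Real.Gamma (((n : ℝ) + 1) / 2)) ∧
      CubeProjection.expect (fun u : CubeProjection.Sph n => CubeProjection.mw u)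
        = CubeProjection.expect (fun u : CubeProjection.Sph n => CubeProjection.vl u)) := by
  have hmw : ∀ n : ℕ, 2 ≤ n →
      CubeProjection.expect (fun u : CubeProjection.Sph n => CubeProjection.mw u)
        = n * CubeProjection.meanAbsCoord n := fun n hn => CubeProjection.expect_mw hn
  have hvl : ∀ n : ℕ, 2 ≤ n →
      CubeProjection.expect (fun u : CubeProjection.Sph n => CubeProjection.vl u)
        = n * CubeProjection.meanAbsCoord n := fun n hn => by
    simp only [CubeProjection.vl_eq]
    exact CubeProjection.expect_sum_abs hn
  have hfour : ((4 : ℕ) : ℝ) * CubeProjection.meanAbsCoord 4 = 16 / (3 * Real.pi) := by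
    rw [CubeProjection.meanAbsCoord_four]
    push_cast
    ring
  refine ⟨CubeProjection.mw_four, (hmw 4 (by norm_num)).trans hfour,
    (hvl 4 (by norm_num)).trans hfour, CubeProjection.expect_mw_sq, ?_,
    CubeProjection.expect_vl_sq, CubeProjection.isGreatest_mw_four,
    CubeProjection.isLeast_mw_four, fun n hn => ⟨?_, (hmw n hn).trans (hvl n hn).symm⟩⟩
  · rw [CubeProjection.expect_mw_sq, CubeProjection.expect_vl_sq]
    exact CubeProjection.second_moment_lt
  · rw [hmw n hn, CubeProjection.meanAbsCoord]
    ring
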